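/- Digraphs are finite, without loops and without parallel arcs (two opposite arcs between the same two vertices are allowed). For a digraph $D$ and a vertex $v$, let $N^+(v)$ and $N^-(v)$ be the sets of out-neighbours and in-neighbours of $v$, let $m^+(v)$ and $m^-(v)$ be the numbers of arcs of the subdigraphs of $D$ induced by $N^+(v)$ and by $N^-(v)$ respectively, and let $\Delta_{\max}(D)=\max_{v\in V(D)}\max(|N^+(v)|,|N^-(v)|)$. The dichromatic number $\vec{\chi}(D)$ is the smallest $k$ such that $V(D)$ can be coloured with $k$ colours so that every colour class induces a subdigraph without directed cycles. By $\log$ we mean the natural logarithm, and $\log^3\Delta=(\log\Delta)^3$. There exists an integer $\Delta_1\geq 2$ such that the following holds. Let $D$ be a digraph with $\Delta_{\max}(D)=\Delta\geq\Delta_1$ and let $a\in\mathbb{R}$ be such that $a>\frac{\log^3\Delta}{\Delta-1}$ and, for every vertex $v\in V(D)$, $\min(m^+(v),m^-(v))\leq(1-a)\Delta(\Delta-1)$. Then \[\vec{\chi}(D)\leq\left(1-\frac{a}{5e^7}\right)(\Delta+1).\] -/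

import Mathlib

namespace Digraph

variable {V : Type*}

/-- A digraph without loops. Parallel arcs are impossible in `Digraph`, while two opposite arcs
between the same vertices (a digon) are allowed. -/
def IsLoopless (D : Digraph V) : Prop :=
  ∀ v, ¬ D.Adj v v

/-- The subdigraph induced by a set of vertices. -/
def induce (D : Digraph V) (S : Set V) : Digraph S where
  Adj u v := D.Adj u v

/-- The out-neighbourhood `N⁺(v)`. -/
def outNbhd (D : Digraph V) (v : V) : Set V :=
  {w | D.Adj v w}

/-- The in-neighbourhood `N⁻(v)`. -/
def inNbhd (D : Digraph V) (v : V) : Set V :=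
  {w | D.Adj w v}

/-- The out-degree `d⁺(v)`. -/
noncomputable def outDeg (D : Digraph V) (v : V) : ℕ :=
  (D.outNbhd v).ncard

/-- The in-degree `d⁻(v)`. -/
noncomputable def inDeg (D : Digraph V) (v : V) : ℕ :=
  (D.inNbhd v).ncard

/-- The maximum degree `Δ_max(D)`, the maximum over all vertices of `max (d⁺(v)) (d⁻(v))`. -/
noncomputable def maxDeg [Fintype V] (D : Digraph V) : ℕ :=
  Finset.univ.sup fun v => max (D.outDeg v) (D.inDeg v)

/-- The number of arcs of a digraph. -/
noncomputable def arcCount (D : Digraph V) : ℕ :=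
  {p : V × V | D.Adj p.1 p.2}.ncard

/-- `m⁺(v)`, the number of arcs of the subdigraph induced by `N⁺(v)`. -/
noncomputable def mOut (D : Digraph V) (v : V) : ℕ :=
  (D.induce (D.outNbhd v)).arcCount

/-- `m⁻(v)`, the number of arcs of the subdigraph induced by `N⁻(v)`. -/
noncomputable def mIn (D : Digraph V) (v : V) : ℕ :=
  (D.induce (D.inNbhd v)).arcCount

/-- `c` lists, in cyclic order and without repetition, the vertices of a directed cycle of length
`n + 1` (addition in `Fin (n + 1)` is cyclic). Length one would be a loop, length two a digon. -/
def IsDirectedCycle (D : Digraph V) {n : ℕ} (c : Fin (n + 1) → V) : Prop :=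
  Function.Injective c ∧ ∀ i, D.Adj (c i) (c (i + 1))

/-- A digraph is acyclic if it has no directed cycle. -/
def IsAcyclic (D : Digraph V) : Prop :=
  ∀ (n : ℕ) (c : Fin (n + 1) → V), ¬ D.IsDirectedCycle c

/-- A `k`-dicolouring: every colour class induces an acyclic subdigraph. -/
def IsDicolouring (D : Digraph V) {k : ℕ} (α : V → Fin k) : Prop :=
  ∀ i : Fin k, (D.induce {v | α v = i}).IsAcyclic

/-- The dichromatic number, the least `k` such that `D` admits a `k`-dicolouring. -/
noncomputable def dichromaticNumber (D : Digraph V) : ℕ :=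
  sInf {k : ℕ | ∃ α : V → Fin k, D.IsDicolouring α}

/-- A finite loopless digraph has a dicolouring, so the infimum that defines its dichromatic
number is attained. -/
theorem exists_isDicolouring_dichromaticNumber [Finite V] (D : Digraph V) (hD : D.IsLoopless) :
    ∃ α : V → Fin D.dichromaticNumber, D.IsDicolouring α := by
  have h : {k : ℕ | ∃ α : V → Fin k, D.IsDicolouring α}.Nonempty := by
    obtain ⟨n, ⟨e⟩⟩ := Finite.exists_equiv_fin V
    refine ⟨n, e, fun i m c hc => hD (c 0) ?_⟩
    have h1 : c (0 + 1) = c 0 :=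
      Subtype.ext (e.injective ((c (0 + 1)).2.trans (c 0).2.symm))
    have h2 : D.Adj (c 0) (c (0 + 1)) := hc.2 0
    rwa [h1] at h2
  exact Nat.sInf_mem h

end Digraph

/-!
A random partial dicolouring with about `Δ / 2` colours is extended greedily. For each vertex `v`
let `N v` be the one of its two neighbourhoods that spans fewer arcs. A vertex `v` may safely take
any colour that is absent from `N v`, since every directed cycle through `v` meets `N v`; so a
partial dicolouring extends to `q` colours as soon as, for each `v`, the colours used on `N v` and
the uncoloured vertices of `N v` together number less than `q`
(`Digraph.exists_isDicolouring_of_partial`). Each colour that is repeated on `N v` saves one.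

The random colouring offers each of `C = Δ / 2` colours to each vertex independently with
probability `1 / M`, where `M = 4 Δ`; a vertex tentatively accepts the first colour offered, and
loses it again if it has both an in-neighbour and an out-neighbour of the same tentative colour.
What remains is a partial dicolouring, because every vertex of a monochromatic cycle would lose its
colour. If `u w` is not an arc, `u, w ∈ N v` both accept `c`, and `c` is offered to no other vertex
in `N v` or near `u` or `w`, then both keep it and `c` is repeated on `N v`; such a colour is *good*
for `v`. As `N v` misses about `a Δ²` ordered pairs, the expected number of good colours is of order
`a Δ`, with a constant well above the `2 / (5 e⁷)` that is needed.

Offering the colours one after another makes the concentration elementary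
(`RandomColouring.prob_few_good_le`): as long as the vertices that accepted an earlier colour meet
at most half of the missing pairs, the next colour is good with conditional probability of order
`a`, whatever the history, so few good colours have probability `exp (-Ω(a Δ))`
(`FiniteProb.prob_few_successes_le`), and the accepting vertices meet more than half of the pairs
with such a probability too, by a Chernoff bound for a weighted sum of independent indicators
(`FiniteProb.prob_weight_ge_le`). Since `a Δ > log³ Δ`, these probabilities are far below
`Δ ^ (-4)`. Whether a colour is good for `v` depends on the choices at distance at most two from
`v`, so the local lemma (`FiniteProb.exists_forall_notMem_of_local`) yields a colouring in which
every vertex has enough good colours.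
-/

open Finset Function
open scoped BigOperators

/-! ### Finite probability, the local lemma and two tail bounds -/

namespace FiniteProb

/-- The probability of an event under the uniform distribution on a finite type. -/
noncomputable def prob {Ω : Type*} [Fintype Ω] (A : Set Ω) : ℝ :=
  𝔼 ω, A.indicator (fun _ => (1 : ℝ)) ω

section Basic

variable {Ω : Type*} [Fintype Ω]

theorem prob_mono {A B : Set Ω} (h : A ⊆ B) : prob A ≤ prob B :=
  expect_le_expect fun ω _ => Set.indicator_le_indicator_of_subset h (fun _ => zero_le_one) ω

theorem prob_nonneg (A : Set Ω) : 0 ≤ prob A :=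
  expect_nonneg fun ω _ => Set.indicator_nonneg (fun _ _ => zero_le_one) ω

theorem prob_univ [Nonempty Ω] : prob (Set.univ : Set Ω) = 1 := by
  simp [prob, expect_const]

theorem nonempty_of_prob_pos {A : Set Ω} (h : 0 < prob A) : A.Nonempty := by
  by_contra hA
  rw [Set.not_nonempty_iff_eq_empty] at hA
  simp [hA, prob] at h

theorem prob_le_expect {A : Set Ω} {F : Ω → ℝ} (hF : ∀ ω, 0 ≤ F ω) (h : ∀ ω ∈ A, 1 ≤ F ω) :
    prob A ≤ 𝔼 ω, F ω :=
  expect_le_expect fun ω _ => Set.indicator_le' (f := fun _ => (1 : ℝ)) (g := F) h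
    (fun ω _ => hF ω) ω

theorem prob_union_le (A B : Set Ω) : prob (A ∪ B) ≤ prob A + prob B := by
  unfold prob
  rw [← expect_add_distrib]
  refine prob_le_expect (fun ω => ?_) fun ω hω => ?_
  · exact add_nonneg (Set.indicator_nonneg (fun _ _ => zero_le_one) ω)
      (Set.indicator_nonneg (fun _ _ => zero_le_one) ω)
  · by_cases hA : ω ∈ A <;> by_cases hB : ω ∈ B <;> simp_all

theorem prob_exists_le {J : Type*} (S : Finset J) (A : J → Set Ω) :
    prob {ω | ∃ j ∈ S, ω ∈ A j} ≤ ∑ j ∈ S, prob (A j) := by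
  unfold prob
  rw [← expect_sum_comm]
  refine prob_le_expect (fun ω => ?_) fun ω hω => ?_
  · exact sum_nonneg fun j _ => Set.indicator_nonneg (fun _ _ => zero_le_one) ω
  · obtain ⟨j, hj, hω⟩ := hω
    calc (1 : ℝ) = (A j).indicator (fun _ => (1 : ℝ)) ω := by simp [hω]
      _ ≤ _ := single_le_sum (f := fun j => (A j).indicator (fun _ => (1 : ℝ)) ω)
        (fun j _ => Set.indicator_nonneg (fun _ _ => zero_le_one) ω) hj

theorem prob_preimage_equiv {Ω' : Type*} [Fintype Ω'] (e : Ω' ≃ Ω) (A : Set Ω) :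
    prob (e ⁻¹' A) = prob A :=
  Fintype.expect_equiv e _ _ fun _ => rfl

end Basic

section Product

variable {I Γ : Type*} [Fintype I] [DecidableEq I] [Fintype Γ]

/-- In a product space, a random variable may be averaged over one coordinate first. -/
theorem expect_update [Nonempty Γ] (i : I) (F : (I → Γ) → ℝ) :
    𝔼 ω, F ω = 𝔼 ω, 𝔼 γ, F (update ω i γ) := by
  -- Exchanging the value at `i` with an independent value is an involution of `(I → Γ) × Γ`.
  let e : (I → Γ) × Γ ≃ (I → Γ) × Γ :=
    { toFun := fun p => (update p.1 i p.2, p.1 i)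
      invFun := fun p => (update p.1 i p.2, p.1 i)
      left_inv := fun p => by simp
      right_inv := fun p => by simp }
  have h1 : 𝔼 p : (I → Γ) × Γ, F (e p).1 = 𝔼 p : (I → Γ) × Γ, F p.1 :=
    Fintype.expect_equiv e _ _ fun _ => rfl
  rw [← univ_product_univ, expect_product, expect_product] at h1
  simp only [expect_const univ_nonempty] at h1
  exact h1.symm

/-- Functions of different coordinates are independent. -/
theorem expect_prod (f : I → Γ → ℝ) :
    𝔼 ω : I → Γ, ∏ i, f i (ω i) = ∏ i, 𝔼 γ, f i γ := by
  simp only [Fintype.expect_eq_sum_div_card]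
  rw [prod_div_distrib, prod_univ_sum, Fintype.piFinset_univ]
  simp

/-- Events that depend on disjoint sets of coordinates are independent. -/
theorem prob_inter_eq_mul (D : Finset I) (A B : Set (I → Γ))
    (hA : ∀ ω ω' : I → Γ, (∀ x ∈ D, ω x = ω' x) → ω ∈ A → ω' ∈ A)
    (hB : ∀ ω ω' : I → Γ, (∀ x ∉ D, ω x = ω' x) → ω ∈ B → ω' ∈ B) :
    prob (A ∩ B) = prob A * prob B := by
  rcases isEmpty_or_nonempty (I → Γ) with h | h
  · simp [prob]
  -- Exchanging the coordinates in `D` of two independent samples is an involution.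
  let m : (I → Γ) → (I → Γ) → I → Γ := fun ω ω' x => if x ∈ D then ω x else ω' x
  let e : (I → Γ) × (I → Γ) ≃ (I → Γ) × (I → Γ) :=
    { toFun := fun p => (m p.1 p.2, m p.2 p.1)
      invFun := fun p => (m p.1 p.2, m p.2 p.1)
      left_inv := fun p => by
        ext x <;> by_cases hx : x ∈ D <;> simp [m, hx]
      right_inv := fun p => by
        ext x <;> by_cases hx : x ∈ D <;> simp [m, hx] }
  have h1 : 𝔼 p : (I → Γ) × (I → Γ), (A ∩ B).indicator (fun _ => (1 : ℝ)) p.1 =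
      𝔼 p : (I → Γ) × (I → Γ),
        A.indicator (fun _ => (1 : ℝ)) p.1 * B.indicator (fun _ => (1 : ℝ)) p.2 := by
    refine Fintype.expect_equiv e _ _ fun p => ?_
    have hA' : (e p).1 ∈ A ↔ p.1 ∈ A :=
      ⟨hA _ _ fun x hx => by simp [e, m, hx], hA _ _ fun x hx => by simp [e, m, hx]⟩
    have hB' : (e p).2 ∈ B ↔ p.1 ∈ B :=
      ⟨hB _ _ fun x hx => by simp [e, m, hx], hB _ _ fun x hx => by simp [e, m, hx]⟩
    by_cases h1 : p.1 ∈ A <;> by_cases h2 : p.1 ∈ B <;> simp [h1, h2, hA', hB']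
  rw [← univ_product_univ, expect_product, expect_product] at h1
  simp only [expect_const univ_nonempty, ← mul_expect, ← expect_mul] at h1
  exact h1

/-- The symmetric **Lovász local lemma** in a product space: `A v` depends only on the coordinates
in `D v`, and every `D v` meets at most `d` of the sets `D u`. -/
theorem exists_forall_notMem_of_local [Nonempty Γ] (D : I → Finset I) (A : I → Set (I → Γ))
    (hA : ∀ v, ∀ ω ω' : I → Γ, (∀ x ∈ D v, ω x = ω' x) → ω ∈ A v → ω' ∈ A v)
    {p : ℝ} {d : ℕ} (hp : ∀ v, prob (A v) ≤ p)
    (hd : ∀ v, #{u | ¬ Disjoint (D v) (D u)} ≤ d) (hd1 : 1 ≤ d) (hpd : 4 * p * d ≤ 1) :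
    ∃ ω, ∀ v, ω ∉ A v := by
  rcases isEmpty_or_nonempty I with hI | ⟨⟨v₀⟩⟩
  · exact ⟨isEmptyElim, isEmptyElim⟩
  have hp0 : 0 ≤ p := (prob_nonneg _).trans (hp v₀)
  have hd1' : (1 : ℝ) ≤ d := by exact_mod_cast hd1
  let G : Finset I → Set (I → Γ) := fun S => {ω | ∀ v ∈ S, ω ∉ A v}
  -- Conditioning on the absence of any set of events at most doubles the bound `p`.
  have key : ∀ n : ℕ, ∀ S : Finset I, #S = n → ∀ v, prob (A v ∩ G S) ≤ 2 * p * prob (G S) := by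
    intro n
    induction n using Nat.strong_induction_on with
    | _ n ih =>
      intro S hS v
      set S₁ := S.filter fun u => Disjoint (D v) (D u) with hS₁
      set S₂ := S.filter fun u => ¬ Disjoint (D v) (D u) with hS₂
      have hS₂d : (#S₂ : ℝ) ≤ d := by
        exact_mod_cast (card_le_card (filter_subset_filter _ (subset_univ S))).trans (hd v)
      have h1 : prob (A v ∩ G S) ≤ prob (A v) * prob (G S₁) := by
        rw [← prob_inter_eq_mul (D v) (A v) (G S₁) (hA v)]
        · exact prob_mono fun ω hω => ⟨hω.1, fun u hu => hω.2 u (mem_filter.1 hu).1⟩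
        · intro ω ω' h hω u hu hu'
          refine hω u hu (hA u ω' ω (fun x hx => (h x fun hxv => ?_).symm) hu')
          exact disjoint_left.1 (mem_filter.1 hu).2 hxv hx
      have h2 : prob (G S₁) ≤ 2 * prob (G S) := by
        rcases S₂.eq_empty_or_nonempty with he | hne
        · have : S₁ = S := filter_true_of_mem fun u hu => by
            by_contra hc
            exact notMem_empty u (he ▸ mem_filter.2 ⟨hu, hc⟩)
          rw [this]
          linarith [prob_nonneg (G S)]
        · have hlt : #S₁ < n := by
            have h3 : #S₁ + #S₂ = #S := by
              convert card_filter_add_card_filter_not (s := S) fun u => Disjoint (D v) (D u)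
            have := hne.card_pos
            omega
          have h3 : prob (G S₁) ≤ prob (G S) + ∑ u ∈ S₂, prob (A u ∩ G S₁) := by
            refine (prob_mono (B := G S ∪ {ω | ∃ u ∈ S₂, ω ∈ A u ∩ G S₁}) fun ω hω => ?_).trans
              ((prob_union_le _ _).trans (add_le_add_right (prob_exists_le _ _) _))
            by_cases hc : ω ∈ G S
            · exact Or.inl hc
            · simp only [G, Set.mem_ofPred_eq, not_forall, not_not] at hc
              obtain ⟨u, hu, huA⟩ := hc
              refine Or.inr ⟨u, mem_filter.2 ⟨hu, fun hdj => ?_⟩, huA, hω⟩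
              exact hω u (mem_filter.2 ⟨hu, hdj⟩) huA
          have h4 : ∑ u ∈ S₂, prob (A u ∩ G S₁) ≤ #S₂ * (2 * p * prob (G S₁)) := by
            rw [← nsmul_eq_mul]
            exact sum_le_card_nsmul _ _ _ fun u _ => ih _ hlt S₁ rfl u
          have h5 : (#S₂ : ℝ) * (2 * p * prob (G S₁)) ≤ d * (2 * p * prob (G S₁)) :=
            mul_le_mul_of_nonneg_right hS₂d (by have := prob_nonneg (G S₁); positivity)
          nlinarith [prob_nonneg (G S₁)]
      calc prob (A v ∩ G S) ≤ prob (A v) * prob (G S₁) := h1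
        _ ≤ p * (2 * prob (G S)) := mul_le_mul (hp v) h2 (prob_nonneg _) hp0
        _ = _ := by ring
  have hp2 : 4 * p ≤ 1 := by nlinarith
  have pos : ∀ S : Finset I, 0 < prob (G S) := by
    intro S
    induction S using Finset.induction_on with
    | empty => simp [G, prob_univ]
    | insert v S _ ih =>
      have h1 : prob (G S) ≤ prob (G (insert v S)) + prob (A v ∩ G S) := by
        refine (prob_mono fun ω hω => ?_).trans (prob_union_le _ _)
        by_cases hv : ω ∈ A v
        · exact Or.inr ⟨hv, hω⟩
        · refine Or.inl fun u hu => ?_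
          rcases mem_insert.1 hu with rfl | hu
          exacts [hv, hω u hu]
      have h2 := key _ S rfl v
      nlinarith
  obtain ⟨ω, hω⟩ := nonempty_of_prob_pos (pos univ)
  exact ⟨ω, fun v => hω v (mem_univ v)⟩

/-- **Chernoff bound** for the weight of the coordinates that fall into a set `R` of probability
at most `r`. -/
theorem prob_weight_ge_le [Nonempty Γ] (R : Set Γ) {r : ℝ} (hR : prob R ≤ r) (w : I → ℝ) {L : ℝ}
    (hL : 0 < L) (hw : ∀ x, 0 ≤ w x) (hwL : ∀ x, w x ≤ L) (t : ℝ) :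
    prob {ω : I → Γ | t ≤ ∑ x, w x * R.indicator (fun _ => (1 : ℝ)) (ω x)} ≤
      Real.exp (-(t / (2 * L)) + 3 / 4 * r / L * ∑ x, w x) := by
  have h1 : prob {ω : I → Γ | t ≤ ∑ x, w x * R.indicator (fun _ => (1 : ℝ)) (ω x)} ≤
      𝔼 ω : I → Γ, Real.exp (-(t / (2 * L))) *
        ∏ x, Real.exp (w x * R.indicator (fun _ => (1 : ℝ)) (ω x) / (2 * L)) := by
    refine prob_le_expect (fun ω => by positivity) fun ω hω => ?_
    rw [← Real.exp_sum, ← Real.exp_add, ← sum_div]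
    refine Real.one_le_exp ?_
    have : t / (2 * L) ≤ (∑ x, w x * R.indicator (fun _ => (1 : ℝ)) (ω x)) / (2 * L) :=
      div_le_div_of_nonneg_right hω (by positivity)
    linarith
  refine h1.trans ?_
  rw [← mul_expect, expect_prod fun x γ =>
    Real.exp (w x * R.indicator (fun _ => (1 : ℝ)) γ / (2 * L)), Real.exp_add, mul_sum,
    Real.exp_sum]
  refine mul_le_mul_of_nonneg_left (prod_le_prod (fun x _ => ?_) fun x _ => ?_) (Real.exp_nonneg _)
  · exact expect_nonneg fun γ _ => Real.exp_nonneg _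
  · set y := w x / (2 * L) with hy
    have hy0 : 0 ≤ y := div_nonneg (hw x) (by positivity)
    have hy1 : y ≤ 1 / 2 := by
      rw [hy, div_le_iff₀ (by positivity)]
      linarith [hwL x]
    have h2 : Real.exp y - 1 ≤ 3 / 2 * y := by
      have h := Real.abs_exp_sub_one_sub_id_le (x := y) (by rw [abs_of_nonneg hy0]; linarith)
      have := (abs_le.1 h).2
      nlinarith
    have h3 : 𝔼 γ, Real.exp (w x * R.indicator (fun _ => (1 : ℝ)) γ / (2 * L)) =
        1 + (Real.exp y - 1) * prob R := by
      have h4 : ∀ γ, Real.exp (w x * R.indicator (fun _ => (1 : ℝ)) γ / (2 * L)) =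
          1 + (Real.exp y - 1) * R.indicator (fun _ => (1 : ℝ)) γ := by
        intro γ
        by_cases hγ : γ ∈ R <;> simp [hγ, hy]
      simp only [h4, expect_add_distrib, ← mul_expect, expect_const univ_nonempty, prob]
    rw [h3]
    have hr : 0 ≤ r := (prob_nonneg R).trans hR
    have h5 : (Real.exp y - 1) * prob R ≤ 3 / 2 * y * r :=
      mul_le_mul h2 hR (prob_nonneg R) (by positivity)
    have h6 : 3 / 4 * r / L * w x = 3 / 2 * y * r := by
      rw [hy]; field_simp; ring
    rw [h6]
    linarith [Real.add_one_le_exp (3 / 2 * y * r)]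

end Product

/-- Lower tail for the number of successes in `n` rounds that are exposed one after another. As
long as the history is in `ok`, the next round succeeds with conditional probability at least
`g`. -/
theorem prob_few_successes_le {Γ : Type*} [Fintype Γ] [Nonempty Γ] {n : ℕ}
    (good : Fin n → Set (Fin n → Γ)) (ok : ℕ → Set (Fin n → Γ)) {g : ℝ}
    (hgood : ∀ i j, i < j → ∀ ω γ, update ω j γ ∈ good i ↔ ω ∈ good i)
    (hok : ∀ (k : Fin n) ω γ, update ω k γ ∈ ok (k + 1) → ω ∈ ok k)
    (hg : ∀ k : Fin n, ∀ ω ∈ ok k, g ≤ prob {γ | update ω k γ ∈ good k}) (s : ℝ)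
    [∀ ω, DecidablePred fun k => ω ∈ good k] :
    prob {ω | ω ∈ ok n ∧ (#{k | ω ∈ good k} : ℝ) < s} ≤ Real.exp (s - n * g / 2) := by
  -- `Z k` is `2` to the minus the number of successes before round `k`, killed outside `ok k`.
  let P : ℕ → (Fin n → Γ) → ℝ := fun k ω =>
    ∏ i ∈ univ.filter fun i : Fin n => (i : ℕ) < k, if ω ∈ good i then (1 / 2 : ℝ) else 1
  let Z : ℕ → (Fin n → Γ) → ℝ := fun k => (ok k).indicator (P k)
  have hP : ∀ k ω, 0 ≤ P k ω := fun k ω => prod_nonneg fun i _ => by split_ifs <;> norm_num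
  have hZ : ∀ k ω, 0 ≤ Z k ω := fun k ω => Set.indicator_nonneg (fun _ _ => hP _ _) ω
  have step : ∀ k : Fin n, 𝔼 ω, Z (k + 1) ω ≤ Real.exp (-g / 2) * 𝔼 ω, Z k ω := by
    intro k
    rw [expect_update k, mul_expect]
    refine expect_le_expect fun ω _ => ?_
    by_cases hω : ω ∈ ok k
    swap
    · have : ∀ γ, Z (k + 1) (update ω k γ) = 0 := fun γ =>
        Set.indicator_of_notMem (fun h => hω (hok k ω γ h)) _
      simp only [this, expect_const univ_nonempty]
      exact mul_nonneg (Real.exp_nonneg _) (hZ _ _)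
    have h1 : ∀ γ, Z (k + 1) (update ω k γ) ≤
        P k ω * (1 - 1 / 2 * {γ | update ω k γ ∈ good k}.indicator (fun _ => (1 : ℝ)) γ) := by
      intro γ
      refine (Set.indicator_le_self' (fun _ _ => hP _ _) _).trans (le_of_eq ?_)
      have h2 : (univ.filter fun i : Fin n => (i : ℕ) < k + 1) =
          insert k (univ.filter fun i : Fin n => (i : ℕ) < k) := by
        ext i
        simp only [mem_filter, mem_univ, true_and, mem_insert, Fin.ext_iff]
        omega
      simp only [P]
      rw [h2, prod_insert (by simp), mul_comm]
      congr 1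
      · refine prod_congr rfl fun i hi => ?_
        simp only [hgood i k (Fin.lt_def.2 (mem_filter.1 hi).2)]
      · by_cases h : update ω k γ ∈ good k <;> simp [h]
        norm_num
    calc 𝔼 γ, Z (k + 1) (update ω k γ)
        ≤ 𝔼 γ, P k ω *
          (1 - 1 / 2 * {γ | update ω k γ ∈ good k}.indicator (fun _ => (1 : ℝ)) γ) :=
          expect_le_expect fun γ _ => h1 γ
      _ = P k ω * (1 - 1 / 2 * prob {γ | update ω k γ ∈ good k}) := by
          rw [← mul_expect, expect_sub_distrib, ← mul_expect, expect_const univ_nonempty, prob]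
      _ ≤ P k ω * Real.exp (-g / 2) := by
          refine mul_le_mul_of_nonneg_left ?_ (hP _ _)
          linarith [hg k ω hω, Real.add_one_le_exp (-g / 2)]
      _ = Real.exp (-g / 2) * Z k ω := by
          rw [mul_comm]; simp [Z, hω]
  have iter : ∀ k : ℕ, k ≤ n → 𝔼 ω, Z k ω ≤ Real.exp (-(k * g / 2)) := by
    intro k
    induction k with
    | zero =>
      intro _
      refine (expect_le_expect (g := fun _ => (1 : ℝ)) fun ω _ => ?_).trans
        (by simp [expect_const univ_nonempty])
      exact Set.indicator_le' (fun ω _ => by simp [P]) (fun _ _ => zero_le_one) ω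
    | succ k ih =>
      intro hk
      refine (step ⟨k, hk⟩).trans ?_
      have := mul_le_mul_of_nonneg_left (ih (by omega)) (Real.exp_nonneg (-g / 2))
      refine this.trans (le_of_eq ?_)
      rw [← Real.exp_add]
      congr 1
      push_cast
      ring
  have h1 : prob {ω | ω ∈ ok n ∧ (#{k | ω ∈ good k} : ℝ) < s} ≤ 𝔼 ω, Real.exp s * Z n ω := by
    refine prob_le_expect (fun ω => mul_nonneg (Real.exp_nonneg _) (hZ _ _)) fun ω hω => ?_
    obtain ⟨hωok, hωs⟩ := hω
    have h2 : Z n ω = (1 / 2 : ℝ) ^ #{k | ω ∈ good k} := by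
      simp only [Z, P, Set.indicator_of_mem hωok]
      rw [filter_true_of_mem fun i _ => i.2, prod_ite]
      simp
    rw [h2]
    set m := #{k | ω ∈ good k}
    calc (1 : ℝ) = (2 * (1 / 2)) ^ m := by norm_num
      _ = 2 ^ m * (1 / 2) ^ m := mul_pow _ _ _
      _ ≤ Real.exp s * (1 / 2) ^ m := by
        refine mul_le_mul_of_nonneg_right ?_ (by positivity)
        calc (2 : ℝ) ^ m ≤ Real.exp 1 ^ m :=
              pow_le_pow_left₀ (by norm_num) (by linarith [Real.add_one_le_exp (1 : ℝ)]) _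
          _ = Real.exp m := by rw [← Real.exp_nat_mul, mul_one]
          _ ≤ Real.exp s := Real.exp_le_exp.2 hωs.le
  refine h1.trans ?_
  rw [← mul_expect, sub_eq_add_neg, Real.exp_add]
  exact mul_le_mul_of_nonneg_left (iter n le_rfl) (Real.exp_nonneg _)

end FiniteProb

/-! ### Good colours in a random colouring -/

namespace FiniteProb

theorem prob_forall_mem {I Γ : Type*} [Fintype I] [DecidableEq I] [Fintype Γ] (A : I → Set Γ) :
    prob {ω : I → Γ | ∀ i, ω i ∈ A i} = ∏ i, prob (A i) := by
  unfold prob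
  rw [← expect_prod fun i => (A i).indicator fun _ => (1 : ℝ)]
  refine expect_congr rfl fun ω _ => ?_
  by_cases h : ∀ i, ω i ∈ A i
  · rw [Set.indicator_of_mem (show ω ∈ {ω | ∀ i, ω i ∈ A i} from h)]
    exact (prod_eq_one fun i _ => Set.indicator_of_mem (h i) _).symm
  · rw [Set.indicator_of_notMem (show ω ∉ {ω | ∀ i, ω i ∈ A i} from h)]
    push Not at h
    obtain ⟨i, hi⟩ := h
    exact (prod_eq_zero (mem_univ i) (Set.indicator_of_notMem hi _)).symm

theorem prob_compl {Ω : Type*} [Fintype Ω] [Nonempty Ω] (A : Set Ω) :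
    prob Aᶜ = 1 - prob A := by
  have h : ∀ ω, Aᶜ.indicator (fun _ => (1 : ℝ)) ω = 1 - A.indicator (fun _ => (1 : ℝ)) ω := by
    intro ω
    by_cases hω : ω ∈ A <;> simp [hω]
  simp only [prob, h, expect_sub_distrib, expect_const univ_nonempty]

theorem prob_fin_val_eq_zero {M : ℕ} (hM : 0 < M) : prob {γ : Fin M | (γ : ℕ) = 0} = 1 / M := by
  have : NeZero M := ⟨hM.ne'⟩
  have h : {γ : Fin M | (γ : ℕ) = 0} = {0} := by
    ext γ
    simp
  rw [h, prob, Fintype.expect_eq_sum_div_card]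
  simp [Set.indicator_apply]

theorem prob_fin_val_ne_zero {M : ℕ} (hM : 0 < M) :
    prob {γ : Fin M | (γ : ℕ) ≠ 0} = 1 - 1 / M := by
  have : NeZero M := ⟨hM.ne'⟩
  rw [← prob_fin_val_eq_zero hM, ← prob_compl]
  rfl

end FiniteProb

namespace RandomColouring

open FiniteProb

section

open scoped Classical

variable {V : Type*} {C M : ℕ}

/-- The vertex `x` gets the tentative colour `c`. Each of the `C` colours is offered to each vertex
independently with probability `1 / M` (the event `ω x c = 0`), and `x` accepts the first colour
that it is offered. -/
def IsTentative (ω : V → Fin C → Fin M) (x : V) (c : Fin C) : Prop :=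
  (ω x c : ℕ) = 0 ∧ ∀ c' < c, (ω x c' : ℕ) ≠ 0

/-- The colour `c` is good for a set `H` of pairs of vertices if both ends of some pair of `H`
accept it while it is offered to no other vertex of the set `S` attached to that pair. -/
def IsGood (H : Finset (V × V)) (S : V × V → Finset V) (ω : V → Fin C → Fin M) (c : Fin C) :
    Prop :=
  ∃ p ∈ H, IsTentative ω p.1 c ∧ IsTentative ω p.2 c ∧
    ∀ x ∈ S p, x ≠ p.1 → x ≠ p.2 → (ω x c : ℕ) ≠ 0

/-- The number of pairs of `H` at `x`. -/
noncomputable def pairDegree (H : Finset (V × V)) (x : V) : ℝ :=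
  ∑ p ∈ H, ((if p.1 = x then 1 else 0) + if p.2 = x then 1 else 0)

theorem pairDegree_nonneg (H : Finset (V × V)) (x : V) : 0 ≤ pairDegree H x :=
  sum_nonneg fun p _ => by positivity

theorem pairDegree_le {N : Finset V} {H : Finset (V × V)} (hH : ∀ p ∈ H, p.1 ∈ N ∧ p.2 ∈ N)
    (x : V) : pairDegree H x ≤ 2 * #N := by
  unfold pairDegree
  rw [sum_add_distrib, sum_boole, sum_boole]
  have h1 : #(H.filter fun p => p.1 = x) ≤ #N := by
    refine card_le_card_of_injOn Prod.snd (fun p hp => (hH p (mem_filter.1 hp).1).2) ?_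
    intro p hp q hq h
    have hp' := (mem_filter.1 hp).2
    have hq' := (mem_filter.1 hq).2
    exact Prod.ext (hp'.trans hq'.symm) h
  have h2 : #(H.filter fun p => p.2 = x) ≤ #N := by
    refine card_le_card_of_injOn Prod.fst (fun p hp => (hH p (mem_filter.1 hp).1).1) ?_
    intro p hp q hq h
    have hp' := (mem_filter.1 hp).2
    have hq' := (mem_filter.1 hq).2
    exact Prod.ext h (hp'.trans hq'.symm)
  have h1' : (#(H.filter fun p => p.1 = x) : ℝ) ≤ #N := by exact_mod_cast h1
  have h2' : (#(H.filter fun p => p.2 = x) : ℝ) ≤ #N := by exact_mod_cast h2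
  linarith

variable [Fintype V]

theorem sum_pairDegree_mul (H : Finset (V × V)) (f : V → ℝ) :
    ∑ x, pairDegree H x * f x = ∑ p ∈ H, (f p.1 + f p.2) := by
  simp only [pairDegree, sum_mul]
  rw [sum_comm]
  refine sum_congr rfl fun p _ => ?_
  simp [add_mul, sum_add_distrib]

/-- The probability that a colour is offered to `u` and `w` and to no other vertex of `S`. -/
theorem le_prob_exactly_pair (hM : 0 < M) {u w : V} (huw : u ≠ w) (S : Finset V) {m : ℕ}
    (hS : #S ≤ m) :
    (1 / M : ℝ) ^ 2 * (1 - 1 / M) ^ m ≤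
      prob {γ : V → Fin M | (γ u : ℕ) = 0 ∧ (γ w : ℕ) = 0 ∧
        ∀ x ∈ S, x ≠ u → x ≠ w → (γ x : ℕ) ≠ 0} := by
  have : NeZero M := ⟨hM.ne'⟩
  have hM1 : (1 : ℝ) ≤ M := by exact_mod_cast hM
  have ha0 : (0 : ℝ) ≤ 1 / M := by positivity
  have ha1 : (1 / M : ℝ) ≤ 1 := by rw [div_le_one (by positivity)]; exact hM1
  let A : V → Set (Fin M) := fun x =>
    if x ∈ ({u, w} : Finset V) then {γ | (γ : ℕ) = 0}
    else if x ∈ S then {γ | (γ : ℕ) ≠ 0} else Set.univ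
  have h1 : {γ : V → Fin M | ∀ x, γ x ∈ A x} ⊆ {γ : V → Fin M | (γ u : ℕ) = 0 ∧ (γ w : ℕ) = 0 ∧
        ∀ x ∈ S, x ≠ u → x ≠ w → (γ x : ℕ) ≠ 0} := by
    intro γ hγ
    refine ⟨?_, ?_, fun x hx hxu hxw => ?_⟩
    · simpa [A] using hγ u
    · simpa [A] using hγ w
    · simpa [A, hx, hxu, hxw] using hγ x
  refine le_trans ?_ (prob_mono h1)
  rw [prob_forall_mem]
  calc (1 / M : ℝ) ^ 2 * (1 - 1 / M) ^ m ≤ (1 / M : ℝ) ^ 2 * (1 - 1 / M) ^ #S :=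
        mul_le_mul_of_nonneg_left (pow_le_pow_of_le_one (by linarith) (by linarith) hS)
          (by positivity)
    _ = ∏ x, ((if x ∈ ({u, w} : Finset V) then (1 / M : ℝ) else 1) *
          if x ∈ S then 1 - (1 / M : ℝ) else 1) := by
        rw [prod_mul_distrib, prod_ite_mem, prod_ite_mem, univ_inter, univ_inter, prod_const,
          prod_const, card_pair huw]
    _ ≤ ∏ x, prob (A x) := by
        refine prod_le_prod (fun x _ => ?_) fun x _ => ?_
        · have h2 : (0 : ℝ) ≤ 1 - 1 / M := by linarith
          split_ifs <;> positivity
        · by_cases hx : x ∈ ({u, w} : Finset V)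
          · simp only [A, if_pos hx, prob_fin_val_eq_zero hM]
            split_ifs <;> nlinarith
          · by_cases hxS : x ∈ S
            · simp only [A, if_neg hx, if_pos hxS, prob_fin_val_ne_zero hM, one_mul, le_refl]
            · simp only [A, if_neg hx, if_neg hxS, prob_univ, one_mul, le_refl]

/-- A vertex is offered some colour with probability at most `C / M`. -/
theorem prob_offered_le (hM : 0 < M) :
    prob {f : Fin C → Fin M | ∃ c, (f c : ℕ) = 0} ≤ C / M := by
  have : NeZero M := ⟨hM.ne'⟩
  have h1 : ∀ c : Fin C, prob {f : Fin C → Fin M | (f c : ℕ) = 0} = 1 / M := by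
    intro c
    have h2 : {f : Fin C → Fin M | (f c : ℕ) = 0} =
        {f | ∀ c', f c' ∈ if c' = c then {γ : Fin M | (γ : ℕ) = 0} else Set.univ} := by
      ext f
      refine ⟨fun h c' => ?_, fun h => by simpa using h c⟩
      by_cases hc : c' = c
      · subst hc; simpa using h
      · simp [hc]
    rw [h2, prob_forall_mem, prod_eq_single c]
    · rw [if_pos rfl, prob_fin_val_eq_zero hM]
    · intro c' _ hc
      simp [hc, prob_univ]
    · simp
  refine (prob_mono fun f hf => ?_).trans
    ((prob_exists_le univ fun c : Fin C => {f : Fin C → Fin M | (f c : ℕ) = 0}).trans (le_of_eq ?_))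
  · obtain ⟨c, hc⟩ := hf
    exact ⟨c, mem_univ c, hc⟩
  · simp only [h1, sum_const, card_univ, Fintype.card_fin, nsmul_eq_mul, mul_one_div]

/-- If a colour is offered to exactly two vertices of `N`, then it determines at most two ordered
pairs. -/
theorem card_exactly_pair_le {N : Finset V} {H : Finset (V × V)}
    (hH : ∀ p ∈ H, p.1 ∈ N ∧ p.2 ∈ N ∧ p.1 ≠ p.2) (S : V × V → Finset V)
    (hNS : ∀ p ∈ H, N ⊆ S p) (γ : V → Fin M) :
    #(H.filter fun p => (γ p.1 : ℕ) = 0 ∧ (γ p.2 : ℕ) = 0 ∧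
      ∀ x ∈ S p, x ≠ p.1 → x ≠ p.2 → (γ x : ℕ) ≠ 0) ≤ 2 := by
  rcases (H.filter fun p => (γ p.1 : ℕ) = 0 ∧ (γ p.2 : ℕ) = 0 ∧
      ∀ x ∈ S p, x ≠ p.1 → x ≠ p.2 → (γ x : ℕ) ≠ 0).eq_empty_or_nonempty with h | ⟨p₀, hp₀⟩
  · rw [h]; simp
  refine (card_le_card (t := {p₀, p₀.swap}) fun p hp => ?_).trans card_le_two
  obtain ⟨hpH, hp1, hp2, -⟩ := mem_filter.1 hp
  obtain ⟨hp₀H, -, -, hp₀S⟩ := mem_filter.1 hp₀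
  have hmem : ∀ x ∈ N, (γ x : ℕ) = 0 → x = p₀.1 ∨ x = p₀.2 := by
    intro x hx h0
    by_contra! hc
    exact hp₀S x (hNS p₀ hp₀H hx) hc.1 hc.2 h0
  obtain ⟨h1N, h2N, hne⟩ := hH p hpH
  rw [mem_insert, mem_singleton]
  rcases hmem _ h1N hp1 with h1 | h1 <;> rcases hmem _ h2N hp2 with h2 | h2
  · exact absurd (h1.trans h2.symm) hne
  · exact Or.inl (Prod.ext h1 h2)
  · exact Or.inr (Prod.ext h1 h2)
  · exact absurd (h1.trans h2.symm) hne

/-- Few good colours are unlikely. Either the vertices that accept some colour meet at least half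
of the pairs of `H`, or, exposing the offers one colour after another, each colour has a conditional
probability of order `#H / M ^ 2` of being good. -/
theorem prob_few_good_le {N : Finset V} {H : Finset (V × V)}
    (hH : ∀ p ∈ H, p.1 ∈ N ∧ p.2 ∈ N ∧ p.1 ≠ p.2) (S : V × V → Finset V)
    (hNS : ∀ p ∈ H, N ⊆ S p) {m : ℕ} (hS : ∀ p ∈ H, #(S p) ≤ m) {Δ : ℕ} (hΔ : 0 < Δ)
    (hN : #N ≤ Δ) (hM : 0 < M) (hCM : 8 * C ≤ M) (s : ℝ) :
    prob {ω : V → Fin C → Fin M | (#{c | IsGood H S ω c} : ℝ) < s} ≤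
      Real.exp (-((#H : ℝ) / (32 * Δ))) +
      Real.exp (s - C * ((#H : ℝ) / 4 * ((1 / M : ℝ) ^ 2 * (1 - 1 / M) ^ m)) / 2) := by
  have : NeZero M := ⟨hM.ne'⟩
  have hΔ' : (0 : ℝ) < Δ := by exact_mod_cast hΔ
  have hM' : (0 : ℝ) < M := by exact_mod_cast hM
  set h : ℝ := (#H : ℝ) with hh
  let R : Set (Fin C → Fin M) := {f | ∃ c, (f c : ℕ) = 0}
  let used : ℕ → (Fin C → V → Fin M) → V → ℝ := fun k ω x =>
    if ∃ c : Fin C, (c : ℕ) < k ∧ (ω c x : ℕ) = 0 then 1 else 0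
  let ok : ℕ → Set (Fin C → V → Fin M) := fun k =>
    {ω | ∑ x, pairDegree H x * used k ω x < h / 2}
  let good : Fin C → Set (Fin C → V → Fin M) := fun c => {ω | IsGood H S (fun x c => ω c x) c}
  let e : (V → Fin C → Fin M) ≃ (Fin C → V → Fin M) := Equiv.piComm _
  have hsub : {ω : V → Fin C → Fin M | (#{c | IsGood H S ω c} : ℝ) < s} ⊆
      {ω | h / 2 ≤ ∑ x, pairDegree H x * R.indicator (fun _ => (1 : ℝ)) (ω x)} ∪
        e ⁻¹' {ω | ω ∈ ok C ∧ (#{k | ω ∈ good k} : ℝ) < s} := by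
    intro ω hω
    by_cases h1 : h / 2 ≤ ∑ x, pairDegree H x * R.indicator (fun _ => (1 : ℝ)) (ω x)
    · exact Or.inl h1
    · refine Or.inr ⟨?_, hω⟩
      have h2 : ∀ x, used C (e ω) x = R.indicator (fun _ => (1 : ℝ)) (ω x) := by
        intro x
        have h3 : (∃ c : Fin C, (c : ℕ) < C ∧ (e ω c x : ℕ) = 0) ↔ ω x ∈ R :=
          ⟨fun ⟨c, _, hc⟩ => ⟨c, hc⟩, fun ⟨c, hc⟩ => ⟨c, c.2, hc⟩⟩
        simp only [used, h3, Set.indicator_apply]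
      simpa only [ok, h2, Set.mem_ofPred_eq, not_le] using h1
  refine (prob_mono hsub).trans ((prob_union_le _ _).trans (add_le_add ?_ ?_))
  · have hR : prob R ≤ 1 / 8 := by
      refine (prob_offered_le hM).trans ?_
      have : (8 * C : ℝ) ≤ M := by exact_mod_cast hCM
      rw [div_le_div_iff₀ hM' (by norm_num)]
      linarith
    refine (prob_weight_ge_le R hR (pairDegree H) (L := 2 * Δ) (by positivity)
      (pairDegree_nonneg H) (fun x => ?_) (h / 2)).trans (le_of_eq ?_)
    · refine (pairDegree_le (fun p hp => ⟨(hH p hp).1, (hH p hp).2.1⟩) x).trans ?_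
      have : (#N : ℝ) ≤ Δ := by exact_mod_cast hN
      linarith
    · have := sum_pairDegree_mul H fun _ => 1
      simp only [mul_one, sum_const, nsmul_eq_mul] at this
      rw [this, ← hh]
      congr 1
      field_simp
      ring
  · rw [prob_preimage_equiv e]
    refine prob_few_successes_le good ok ?_ ?_ ?_ s
    · intro i j hij ω γ
      have hupd : ∀ c ≤ i, update ω j γ c = ω c := fun c hc =>
        update_of_ne (hc.trans_lt hij).ne _ _
      have hT : ∀ x, IsTentative (fun x c => update ω j γ c x) x i ↔
          IsTentative (fun x c => ω c x) x i := by
        intro x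
        unfold IsTentative
        dsimp only
        rw [hupd i le_rfl]
        exact and_congr_right fun _ => forall₂_congr fun c hc => by rw [hupd c hc.le]
      simp only [good, Set.mem_ofPred_eq, IsGood, hT, hupd i le_rfl]
    · intro k ω γ hω
      have hω' : ∑ x, pairDegree H x * used (k + 1) (update ω k γ) x < h / 2 := hω
      refine lt_of_le_of_lt (sum_le_sum fun x _ => ?_) hω'
      refine mul_le_mul_of_nonneg_left ?_ (pairDegree_nonneg H x)
      by_cases hx : ∃ c : Fin C, (c : ℕ) < k ∧ (ω c x : ℕ) = 0
      · obtain ⟨c, hc, hc0⟩ := hx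
        have h1 : ∃ c : Fin C, (c : ℕ) < k + 1 ∧ (update ω k γ c x : ℕ) = 0 :=
          ⟨c, by omega, by rwa [update_of_ne (Fin.lt_def.2 hc).ne]⟩
        simp only [used, if_pos h1]
        split_ifs <;> norm_num
      · simp only [used, if_neg hx]
        split_ifs <;> norm_num
    · intro k ω hω
      -- `H'` is the set of pairs with no end that was offered an earlier colour.
      set H' := H.filter fun p => used k ω p.1 = 0 ∧ used k ω p.2 = 0 with hH'
      have hcard : h / 2 ≤ #H' := by
        have h1 : ∑ p ∈ H, (used k ω p.1 + used k ω p.2) < h / 2 := by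
          rw [← sum_pairDegree_mul]
          exact hω
        have h2 : (#H : ℝ) - #H' ≤ ∑ p ∈ H, (used k ω p.1 + used k ω p.2) := by
          have h3 : (#H' : ℝ) = ∑ p ∈ H, if used k ω p.1 = 0 ∧ used k ω p.2 = 0 then 1 else 0 := by
            rw [sum_boole]
          rw [h3, card_eq_sum_ones, Nat.cast_sum, ← sum_sub_distrib]
          refine sum_le_sum fun p _ => ?_
          simp only [used]
          split_ifs <;> simp_all
        linarith
      let E : V × V → Set (V → Fin M) := fun p => {γ | (γ p.1 : ℕ) = 0 ∧ (γ p.2 : ℕ) = 0 ∧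
        ∀ x ∈ S p, x ≠ p.1 → x ≠ p.2 → (γ x : ℕ) ≠ 0}
      have hE : ∀ p ∈ H', ((1 / M : ℝ) ^ 2 * (1 - 1 / M) ^ m) ≤ prob (E p) := fun p hp =>
        le_prob_exactly_pair hM (hH p (mem_filter.1 hp).1).2.2 (S p) (hS p (mem_filter.1 hp).1)
      have hEgood : ∀ p ∈ H', ∀ γ ∈ E p, update ω k γ ∈ good k := by
        intro p hp γ hγ
        obtain ⟨hpH, hp1, hp2⟩ := mem_filter.1 hp
        have hearly : ∀ x, used k ω x = 0 → ∀ c < k, (update ω k γ c x : ℕ) ≠ 0 := by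
          intro x hx c hc h0
          rw [update_of_ne hc.ne] at h0
          simp only [used, ite_eq_right_iff, one_ne_zero, imp_false, not_exists, not_and] at hx
          exact hx c hc h0
        refine ⟨p, hpH, ⟨?_, hearly _ hp1⟩, ⟨?_, hearly _ hp2⟩, fun x hx h1 h2 => ?_⟩
        · simpa using hγ.1
        · simpa using hγ.2.1
        · simpa using hγ.2.2 x hx h1 h2
      have h4 : ∑ p ∈ H', prob (E p) ≤ 2 * prob {γ | update ω k γ ∈ good k} := by
        unfold prob
        rw [← expect_sum_comm, mul_expect]
        refine expect_le_expect fun γ _ => ?_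
        by_cases hγ : update ω k γ ∈ good k
        · rw [Set.indicator_of_mem (show γ ∈ {γ | update ω k γ ∈ good k} from hγ)]
          simp only [Set.indicator_apply]
          rw [sum_boole]
          have h5 : #(H'.filter fun p => γ ∈ E p) ≤ 2 :=
            (card_le_card (filter_subset_filter _ (filter_subset _ _))).trans
              (card_exactly_pair_le hH S hNS γ)
          have : (#(H'.filter fun p => γ ∈ E p) : ℝ) ≤ 2 := by exact_mod_cast h5
          linarith
        · rw [Set.indicator_of_notMem (show γ ∉ {γ | update ω k γ ∈ good k} from hγ)]
          refine (sum_eq_zero fun p hp => ?_).le.trans (by norm_num)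
          exact Set.indicator_of_notMem (fun hE => hγ (hEgood p hp γ hE)) _
      have h6 := card_nsmul_le_sum H' _ _ hE
      rw [nsmul_eq_mul] at h6
      have h7 : h / 2 * ((1 / M : ℝ) ^ 2 * (1 - 1 / M) ^ m) ≤
          #H' * ((1 / M : ℝ) ^ 2 * (1 - 1 / M) ^ m) := by
        refine mul_le_mul_of_nonneg_right hcard ?_
        have : (1 / M : ℝ) ≤ 1 := by
          rw [div_le_one hM']
          exact_mod_cast hM
        have h8 : (0 : ℝ) ≤ 1 - 1 / M := by linarith
        positivity
      linarith

end

end RandomColouring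

/-! ### Greedy completion of partial dicolourings -/

namespace Digraph

variable {V : Type*}

theorem induce_isAcyclic_iff (D : Digraph V) (S : Set V) :
    (D.induce S).IsAcyclic ↔
      ∀ (n : ℕ) (c : Fin (n + 1) → V), D.IsDirectedCycle c → ¬ ∀ i, c i ∈ S := by
  constructor
  · intro h n c hc hS
    exact h n (fun i => ⟨c i, hS i⟩)
      ⟨fun i j hij => hc.1 (Subtype.ext_iff.1 hij), fun i => hc.2 i⟩
  · intro h n c hc
    exact h n (fun i => c i) ⟨fun i j hij => hc.1 (Subtype.ext hij), hc.2⟩ fun i => (c i).2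

/-- A directed cycle enters and leaves each of its vertices. -/
theorem IsDirectedCycle.exists_adj {D : Digraph V} {n : ℕ} {c : Fin (n + 1) → V}
    (hc : D.IsDirectedCycle c) (i : Fin (n + 1)) :
    (∃ j, D.Adj (c i) (c j)) ∧ ∃ j, D.Adj (c j) (c i) :=
  ⟨⟨i + 1, hc.2 i⟩, ⟨i - 1, by simpa using hc.2 (i - 1)⟩⟩

/-- A set that contains the whole out-neighbourhood or the whole in-neighbourhood of `v`. -/
def CoversSide (D : Digraph V) (v : V) (N : Finset V) : Prop :=
  (∀ w, D.Adj v w → w ∈ N) ∨ ∀ w, D.Adj w v → w ∈ N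

/-- Greedy completion of a partial dicolouring. The map `β` sends a coloured vertex to its colour
and an uncoloured vertex to itself, so that `N v` has an image of fewer than `q` elements exactly
if its colours and its uncoloured vertices together number less than `q`; this property survives
when further vertices receive a colour. -/
theorem exists_isDicolouring_of_partial [Fintype V] [DecidableEq V] (D : Digraph V)
    (hD : D.IsLoopless) {q : ℕ} (N : V → Finset V) (hN : ∀ v, D.CoversSide v (N v))
    (β : V → Fin q ⊕ V) (hβ : ∀ v w, β v = Sum.inr w → w = v)
    (hac : ∀ i : Fin q, (D.induce {v | β v = Sum.inl i}).IsAcyclic)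
    (hq : ∀ v, #((N v).image β) < q) :
    ∃ α : V → Fin q, D.IsDicolouring α := by
  obtain ⟨m, hm⟩ : ∃ m, m = #{v | β v = Sum.inr v} := ⟨_, rfl⟩
  induction m generalizing β with
  | zero =>
    have h1 : ∀ v, ∃ i, β v = Sum.inl i := by
      intro v
      rcases h : β v with i | w
      · exact ⟨i, rfl⟩
      · have hv : v ∈ univ.filter fun v => β v = Sum.inr v :=
          mem_filter.2 ⟨mem_univ v, by rw [h, hβ v w h]⟩
        rw [card_eq_zero.1 hm.symm] at hv
        exact absurd hv (notMem_empty v)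
    choose α hα using h1
    refine ⟨α, fun i => ?_⟩
    have : {v | α v = i} = {v | β v = Sum.inl i} := by
      ext v
      simp [hα]
    rw [this]
    exact hac i
  | succ m ih =>
    have hne : (univ.filter fun v => β v = Sum.inr v).Nonempty := card_pos.1 (by omega)
    obtain ⟨v, hv⟩ := hne
    have hv' : β v = Sum.inr v := (mem_filter.1 hv).2
    obtain ⟨i, hi⟩ : ∃ i : Fin q, Sum.inl i ∉ (N v).image β := by
      by_contra! hc
      have h1 : univ.image (Sum.inl : Fin q → Fin q ⊕ V) ⊆ (N v).image β := by
        intro y hy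
        obtain ⟨i, _, rfl⟩ := mem_image.1 hy
        exact hc i
      have h2 := card_le_card h1
      rw [card_image_of_injective _ Sum.inl_injective, card_univ, Fintype.card_fin] at h2
      exact absurd (hq v) (by omega)
    have hiN : ∀ w ∈ N v, β w ≠ Sum.inl i := fun w hw h => hi (mem_image.2 ⟨w, hw, h⟩)
    refine ih (update β v (Sum.inl i)) ?_ ?_ ?_ ?_
    · intro u w h
      by_cases hu : u = v
      · subst hu; simp at h
      · rw [update_of_ne hu] at h
        exact hβ u w h
    · intro j
      rw [induce_isAcyclic_iff]
      intro n c hc hS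
      by_cases hvc : ∃ k, c k = v
      · obtain ⟨k, rfl⟩ := hvc
        have hj : i = j := by simpa using hS k
        subst hj
        -- A vertex of the cycle other than the new one already had the colour `i`.
        have hcol : ∀ l, c l ≠ c k → β (c l) = Sum.inl i := fun l hl => by
          have := hS l
          simpa [update_of_ne hl] using this
        obtain ⟨⟨l, hl⟩, l', hl'⟩ := hc.exists_adj k
        rcases hN (c k) with h | h
        · exact hiN _ (h _ hl) (hcol l fun e => hD (c k) (by rwa [e] at hl))
        · exact hiN _ (h _ hl') (hcol l' fun e => hD (c k) (by rwa [e] at hl'))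
      · push Not at hvc
        refine (induce_isAcyclic_iff D _).1 (hac j) n c hc fun k => ?_
        have := hS k
        simpa [update_of_ne (hvc k)] using this
    · intro u
      let f : Fin q ⊕ V → Fin q ⊕ V := fun y => if y = Sum.inr v then Sum.inl i else y
      have hf : update β v (Sum.inl i) = f ∘ β := by
        ext u
        by_cases hu : u = v
        · subst hu; simp [f, hv']
        · rw [update_of_ne hu, comp_apply]
          have : β u ≠ Sum.inr v := fun h => hu (hβ u v h).symm
          simp [f, this]
      rw [hf, ← image_image]
      exact card_image_le.trans_lt (hq u)
    · have h1 : (univ.filter fun u => update β v (Sum.inl i) u = Sum.inr u) =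
          (univ.filter fun u => β u = Sum.inr u).erase v := by
        ext u
        by_cases hu : u = v
        · subst hu; simp
        · simp [hu]
      rw [h1, card_erase_of_mem hv]
      omega

end Digraph

/-! ### Neighbourhoods and good colours in digraphs -/

namespace Digraph

open RandomColouring FiniteProb

section

open scoped Classical

variable {V : Type*}

/-- The ordered pairs of distinct vertices of `N` that are not arcs. -/
noncomputable def missingPairs (D : Digraph V) (N : Finset V) : Finset (V × V) :=
  N.offDiag.filter fun p => ¬ D.Adj p.1 p.2

theorem card_missingPairs (D : Digraph V) (hD : D.IsLoopless) (N : Finset V) :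
    #(D.missingPairs N) + (D.induce (N : Set V)).arcCount + #N = #N * #N := by
  have h1 : (D.induce (N : Set V)).arcCount = #(N.offDiag.filter fun p => D.Adj p.1 p.2) := by
    have h2 : ((fun p : ↥(N : Set V) × ↥(N : Set V) => ((p.1 : V), (p.2 : V))) ''
        {p | (D.induce (N : Set V)).Adj p.1 p.2}) =
        (N.offDiag.filter fun p => D.Adj p.1 p.2 : Finset (V × V)) := by
      ext ⟨u, w⟩
      simp only [Set.mem_image, Set.mem_ofPred_eq, coe_filter, mem_offDiag, induce]
      constructor
      · rintro ⟨⟨⟨u', hu⟩, ⟨w', hw⟩⟩, h, he⟩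
        simp only [Prod.mk.injEq] at he
        obtain ⟨rfl, rfl⟩ := he
        exact ⟨⟨hu, hw, fun e => hD _ (by simpa [e] using h)⟩, h⟩
      · rintro ⟨⟨hu, hw, _⟩, h⟩
        exact ⟨⟨⟨u, hu⟩, ⟨w, hw⟩⟩, h, rfl⟩
    rw [arcCount, ← Set.ncard_coe_finset, ← h2, Set.ncard_image_of_injective]
    rintro ⟨⟨a, ha⟩, ⟨b, hb⟩⟩ ⟨⟨c, hc⟩, ⟨d, hd⟩⟩ h
    simpa using h
  have h3 : #(D.missingPairs N) + #(N.offDiag.filter fun p => D.Adj p.1 p.2) = #N.offDiag := by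
    rw [add_comm, missingPairs]
    convert card_filter_add_card_filter_not (s := N.offDiag) fun p => D.Adj p.1 p.2
  have h4 := offDiag_card N
  have h5 : #N ≤ #N * #N := Nat.le_mul_self _
  omega

variable [Fintype V]

/-- The vertex `v` together with its out-neighbours and its in-neighbours. -/
noncomputable def closedNbhd (D : Digraph V) (v : V) : Finset V :=
  insert v ((D.outNbhd v).toFinset ∪ (D.inNbhd v).toFinset)

theorem mem_closedNbhd {D : Digraph V} {v w : V} :
    w ∈ D.closedNbhd v ↔ w = v ∨ D.Adj v w ∨ D.Adj w v := by
  rw [closedNbhd, mem_insert, mem_union, Set.mem_toFinset, Set.mem_toFinset]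
  rfl

theorem mem_closedNbhd_comm {D : Digraph V} {v w : V} :
    w ∈ D.closedNbhd v ↔ v ∈ D.closedNbhd w := by
  rw [mem_closedNbhd, mem_closedNbhd, eq_comm, or_comm (a := D.Adj v w)]

theorem card_outNbhd_le (D : Digraph V) (v : V) : #(D.outNbhd v).toFinset ≤ D.maxDeg := by
  rw [← Set.ncard_eq_toFinset_card']
  exact (le_max_left _ _).trans
    (le_sup (f := fun v => max (D.outDeg v) (D.inDeg v)) (mem_univ v))

theorem card_inNbhd_le (D : Digraph V) (v : V) : #(D.inNbhd v).toFinset ≤ D.maxDeg := by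
  rw [← Set.ncard_eq_toFinset_card']
  exact (le_max_right _ _).trans
    (le_sup (f := fun v => max (D.outDeg v) (D.inDeg v)) (mem_univ v))

theorem card_closedNbhd_le (D : Digraph V) (v : V) : #(D.closedNbhd v) ≤ 2 * D.maxDeg + 1 := by
  have h1 := card_insert_le v ((D.outNbhd v).toFinset ∪ (D.inNbhd v).toFinset)
  have h2 := card_union_le (D.outNbhd v).toFinset (D.inNbhd v).toFinset
  have h3 := D.card_outNbhd_le v
  have h4 := D.card_inNbhd_le v
  unfold closedNbhd
  omega

/-- The vertices at distance at most two from `v` in the underlying graph. -/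
noncomputable def ballTwo (D : Digraph V) (v : V) : Finset V :=
  (D.closedNbhd v).biUnion D.closedNbhd

theorem card_ballTwo_le (D : Digraph V) (v : V) : #(D.ballTwo v) ≤ (2 * D.maxDeg + 1) ^ 2 := by
  rw [sq]
  exact (card_biUnion_le_card_mul _ _ _ fun w _ => D.card_closedNbhd_le w).trans
    (Nat.mul_le_mul_right _ (D.card_closedNbhd_le v))

theorem mem_ballTwo_comm {D : Digraph V} {v w : V} : w ∈ D.ballTwo v ↔ v ∈ D.ballTwo w := by
  simp only [ballTwo, mem_biUnion]
  exact ⟨fun ⟨x, h1, h2⟩ => ⟨x, mem_closedNbhd_comm.1 h2, mem_closedNbhd_comm.1 h1⟩,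
    fun ⟨x, h1, h2⟩ => ⟨x, mem_closedNbhd_comm.1 h2, mem_closedNbhd_comm.1 h1⟩⟩

theorem card_ballTwo_meeting_le (D : Digraph V) (v : V) :
    #{u | ¬ Disjoint (D.ballTwo v) (D.ballTwo u)} ≤ (2 * D.maxDeg + 1) ^ 4 := by
  have h1 : (univ.filter fun u => ¬ Disjoint (D.ballTwo v) (D.ballTwo u)) ⊆
      (D.ballTwo v).biUnion D.ballTwo := by
    intro u hu
    obtain ⟨x, hx1, hx2⟩ := not_disjoint_iff.1 (mem_filter.1 hu).2
    exact mem_biUnion.2 ⟨x, hx1, mem_ballTwo_comm.1 hx2⟩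
  calc _ ≤ _ := card_le_card h1
    _ ≤ #(D.ballTwo v) * (2 * D.maxDeg + 1) ^ 2 :=
      card_biUnion_le_card_mul _ _ _ fun w _ => D.card_ballTwo_le w
    _ ≤ (2 * D.maxDeg + 1) ^ 2 * (2 * D.maxDeg + 1) ^ 2 :=
      Nat.mul_le_mul_right _ (D.card_ballTwo_le v)
    _ = _ := by ring

/-- The one of the two neighbourhoods of `v` that spans fewer arcs. -/
noncomputable def sparseSide (D : Digraph V) (v : V) : Finset V :=
  if D.mOut v ≤ D.mIn v then (D.outNbhd v).toFinset else (D.inNbhd v).toFinset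

theorem coversSide_sparseSide (D : Digraph V) (v : V) : D.CoversSide v (D.sparseSide v) := by
  unfold sparseSide
  split_ifs
  · exact Or.inl fun w hw => Set.mem_toFinset.2 hw
  · exact Or.inr fun w hw => Set.mem_toFinset.2 hw

theorem card_sparseSide_le (D : Digraph V) (v : V) : #(D.sparseSide v) ≤ D.maxDeg := by
  unfold sparseSide
  split_ifs
  exacts [D.card_outNbhd_le v, D.card_inNbhd_le v]

theorem sparseSide_subset (D : Digraph V) (v : V) : D.sparseSide v ⊆ D.closedNbhd v := by
  intro w hw
  rw [mem_closedNbhd]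
  unfold sparseSide at hw
  split_ifs at hw
  · exact Or.inr (Or.inl (Set.mem_toFinset.1 hw))
  · have h : w ∈ D.inNbhd v := Set.mem_toFinset.1 hw
    exact Or.inr (Or.inr h)

theorem arcCount_induce_sparseSide (D : Digraph V) (v : V) :
    (D.induce (D.sparseSide v : Set V)).arcCount = min (D.mOut v) (D.mIn v) := by
  by_cases h : D.mOut v ≤ D.mIn v
  · rw [min_eq_left h, sparseSide, if_pos h, Set.coe_toFinset]; rfl
  · rw [min_eq_right (not_le.1 h).le, sparseSide, if_neg h, Set.coe_toFinset]; rfl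

/-- The vertices that, apart from the two ends of `p`, must not be offered the colour of these ends,
so that both ends keep it and it is used exactly twice in `N`. -/
noncomputable def spoilers (D : Digraph V) (N : Finset V) (p : V × V) : Finset V :=
  N ∪ (D.closedNbhd p.1 ∪ D.closedNbhd p.2)

/-- Whether a colour is good for `v` depends only on the random choices near `v`. -/
theorem isGood_of_eqOn_ballTwo {D : Digraph V} {C M : ℕ} {v : V} {N : Finset V}
    (hN : N ⊆ D.closedNbhd v) {ω ω' : V → Fin C → Fin M} (h : ∀ x ∈ D.ballTwo v, ω x = ω' x)
    {c : Fin C} (hc : IsGood (D.missingPairs N) (D.spoilers N) ω c) :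
    IsGood (D.missingPairs N) (D.spoilers N) ω' c := by
  have hsub : ∀ x ∈ N, D.closedNbhd x ⊆ D.ballTwo v := fun x hx =>
    subset_biUnion_of_mem D.closedNbhd (hN hx)
  have hself : ∀ x ∈ N, x ∈ D.ballTwo v := fun x hx =>
    hsub x hx (mem_closedNbhd.2 (Or.inl rfl))
  obtain ⟨p, hp, h1, h2, h3⟩ := hc
  obtain ⟨hp1, hp2, -⟩ := mem_offDiag.1 (mem_filter.1 hp).1
  refine ⟨p, hp, ?_, ?_, fun x hx => ?_⟩
  · unfold IsTentative
    rw [← h _ (hself _ hp1)]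
    exact h1
  · unfold IsTentative
    rw [← h _ (hself _ hp2)]
    exact h2
  · have : x ∈ D.ballTwo v := by
      rcases mem_union.1 hx with hx | hx
      · exact hself x hx
      · rcases mem_union.1 hx with hx | hx
        exacts [hsub _ hp1 hx, hsub _ hp2 hx]
    rw [← h x this]
    exact h3 x hx

/-- If every vertex has enough good colours, then the vertices that keep their tentative colours
form a partial dicolouring that extends greedily: a good colour is repeated in `N v`, hence saves
one colour there. -/
theorem exists_isDicolouring_of_good (D : Digraph V) (hD : D.IsLoopless) {C M q : ℕ} (hCq : C ≤ q)
    (N : V → Finset V) (hN : ∀ v, D.CoversSide v (N v)) (ω : V → Fin C → Fin M)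
    (hω : ∀ v, #(N v) <
      q + #{c | IsGood (D.missingPairs (N v)) (D.spoilers (N v)) ω c}) :
    ∃ α : V → Fin q, D.IsDicolouring α := by
  have huniq : ∀ {x c c'}, IsTentative ω x c → IsTentative ω x c' → c = c' := by
    intro x c c' h h'
    rcases lt_trichotomy c c' with hlt | heq | hgt
    exacts [absurd h.1 (h'.2 c hlt), heq, absurd h'.1 (h.2 c' hgt)]
  -- A vertex with both an out-neighbour and an in-neighbour of its own tentative colour loses it.
  let kept : V → Fin C → Prop := fun x c => IsTentative ω x c ∧
    ¬ ((∃ y, D.Adj x y ∧ IsTentative ω y c) ∧ ∃ y, D.Adj y x ∧ IsTentative ω y c)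
  let β : V → Fin q ⊕ V := fun x =>
    if h : ∃ c, kept x c then Sum.inl (Fin.castLE hCq h.choose) else Sum.inr x
  have hβkept : ∀ {x c}, kept x c → β x = Sum.inl (Fin.castLE hCq c) := by
    intro x c h
    have hex : ∃ c, kept x c := ⟨c, h⟩
    simp only [β, dif_pos hex]
    rw [huniq hex.choose_spec.1 h.1]
  have hkept : ∀ {x i}, β x = Sum.inl i → ∃ c, kept x c ∧ Fin.castLE hCq c = i := by
    intro x i h
    by_cases hex : ∃ c, kept x c
    · simp only [β, dif_pos hex, Sum.inl.injEq] at h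
      exact ⟨_, hex.choose_spec, h⟩
    · simp [β, dif_neg hex] at h
  refine D.exists_isDicolouring_of_partial hD N hN β ?_ ?_ ?_
  · intro v w h
    by_cases hex : ∃ c, kept v c
    · simp [β, dif_pos hex] at h
    · simpa [β, dif_neg hex, eq_comm] using h
  · intro i
    rw [induce_isAcyclic_iff]
    intro n c hc hS
    obtain ⟨⟨j, hj⟩, j', hj'⟩ := hc.exists_adj 0
    obtain ⟨b, hb, hbi⟩ := hkept (hS 0)
    obtain ⟨b₁, hb₁, hbi₁⟩ := hkept (hS j)
    obtain ⟨b₂, hb₂, hbi₂⟩ := hkept (hS j')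
    have e₁ : b₁ = b := Fin.castLE_injective hCq (hbi₁.trans hbi.symm)
    have e₂ : b₂ = b := Fin.castLE_injective hCq (hbi₂.trans hbi.symm)
    subst e₁ e₂
    exact hb.2 ⟨⟨_, hj, hb₁.1⟩, _, hj', hb₂.1⟩
  · intro v
    set G := univ.filter fun c => IsGood (D.missingPairs (N v)) (D.spoilers (N v)) ω c with hG
    let ι : Fin C → Fin q ⊕ V := fun c => Sum.inl (Fin.castLE hCq c)
    have hι : Injective ι := fun c c' h => Fin.castLE_injective hCq (Sum.inl_injective h)
    have hpair : ∀ c ∈ G, ∃ u ∈ N v, ∃ w ∈ N v, u ≠ w ∧ β u = ι c ∧ β w = ι c := by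
      intro c hc
      obtain ⟨⟨u, w⟩, hp, hu, hw, hS⟩ := (mem_filter.1 hc).2
      obtain ⟨hpo, hna⟩ := mem_filter.1 hp
      obtain ⟨huN, hwN, huw⟩ := mem_offDiag.1 hpo
      dsimp only at hu hw hna huN hwN huw hS
      have hnear : ∀ x, x ∈ D.closedNbhd u ∪ D.closedNbhd w → IsTentative ω x c →
          x = u ∨ x = w := by
        intro x hx hxc
        by_contra! hne
        exact hS x (mem_union_right _ hx) hne.1 hne.2 hxc.1
      refine ⟨u, huN, w, hwN, huw, hβkept ⟨hu, ?_⟩, hβkept ⟨hw, ?_⟩⟩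
      · -- The only possible out-neighbour of `u` of this colour is `w`, and `u w` is not an arc.
        rintro ⟨⟨y, hy, hyc⟩, -⟩
        rcases hnear y (mem_union_left _ (mem_closedNbhd.2 (Or.inr (Or.inl hy)))) hyc with rfl | rfl
        exacts [hD _ hy, hna hy]
      · rintro ⟨-, y, hy, hyc⟩
        rcases hnear y (mem_union_right _ (mem_closedNbhd.2 (Or.inr (Or.inr hy)))) hyc with
          rfl | rfl
        exacts [hna hy, hD _ hy]
    have hGsub : G.image ι ⊆ (N v).image β := by
      intro y hy
      obtain ⟨c, hc, rfl⟩ := mem_image.1 hy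
      obtain ⟨u, hu, _, _, _, hβu, _⟩ := hpair c hc
      exact mem_image.2 ⟨u, hu, hβu⟩
    have hcount : #((N v).image β) + #G ≤ #(N v) := by
      rw [card_eq_sum_card_image β (N v), ← card_image_of_injective G hι,
        card_eq_sum_ones ((N v).image β), ← inter_eq_right.2 hGsub, ← filter_mem_eq_inter,
        card_filter, ← sum_add_distrib]
      refine sum_le_sum fun y hy => ?_
      split_ifs with hyG
      · obtain ⟨c, hc, rfl⟩ := mem_image.1 hyG
        obtain ⟨u, hu, w, hw, huw, hβu, hβw⟩ := hpair c hc
        exact one_lt_card.2 ⟨u, mem_filter.2 ⟨hu, hβu⟩, w, mem_filter.2 ⟨hw, hβw⟩, huw⟩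
      · obtain ⟨u, hu, hβu⟩ := mem_image.1 hy
        exact card_pos.2 ⟨u, mem_filter.2 ⟨hu, hβu⟩⟩
    have hv : #(N v) < q + #G := hω v
    omega

/-! ### The quantitative estimates -/

/-- A neighbourhood of `n ≥ Δ - s` vertices that spans at most `(1 - a) Δ (Δ - 1)` arcs misses
almost `a Δ²` ordered pairs if `s` is small. -/
theorem le_card_missing {Δ n m h a s : ℝ} (hΔ : 20 ≤ Δ) (ha : 0 ≤ a) (hn0 : 0 ≤ n) (hnΔ : n ≤ Δ)
    (hns : Δ - s ≤ n) (hs : s ≤ a * Δ / 2000) (hm : m ≤ (1 - a) * Δ * (Δ - 1))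
    (hh : h + m + n = n * n) : 9 / 10 * (a * Δ ^ 2) ≤ h := by
  have h1 : (Δ - n) * (Δ + n - 1) ≤ a * Δ / 2000 * (2 * Δ) :=
    mul_le_mul (by linarith) (by linarith) (by linarith) (by positivity)
  have h2 : a * Δ * 20 ≤ a * Δ * Δ := mul_le_mul_of_nonneg_left hΔ (by positivity)
  nlinarith

/-- The tail bound of `prob_few_good_le` for `Δ / 2` colours and `M = 4 Δ`. -/
theorem prob_few_good_le_exp {N : Finset V} {H : Finset (V × V)}
    (hH : ∀ p ∈ H, p.1 ∈ N ∧ p.2 ∈ N ∧ p.1 ≠ p.2) (S : V × V → Finset V)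
    (hNS : ∀ p ∈ H, N ⊆ S p) {Δ : ℕ} (hS : ∀ p ∈ H, #(S p) ≤ 6 * Δ) (hΔ : 20 ≤ Δ)
    (hN : #N ≤ Δ) {a s : ℝ} (ha : 0 ≤ a) (hHa : 9 / 10 * (a * (Δ : ℝ) ^ 2) ≤ #H)
    (hs : s ≤ a * Δ / 2500) :
    prob {ω : V → Fin (Δ / 2) → Fin (4 * Δ) | (#{c | IsGood H S ω c} : ℝ) < s} ≤
      2 * Real.exp (-(a * Δ / 10000)) := by
  have hΔ' : (20 : ℝ) ≤ Δ := by exact_mod_cast hΔ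
  refine (prob_few_good_le hH S hNS hS (by omega) hN (by omega) (by omega) s).trans ?_
  rw [two_mul]
  refine add_le_add (Real.exp_le_exp.2 ?_) (Real.exp_le_exp.2 ?_)
  · rw [neg_le_neg_iff, le_div_iff₀ (by positivity)]
    nlinarith
  · have h1 : (9 / 20 : ℝ) * Δ ≤ (Δ / 2 : ℕ) := by
      have : (Δ : ℝ) ≤ 2 * (Δ / 2 : ℕ) + 1 := by
        have : Δ ≤ 2 * (Δ / 2) + 1 := by omega
        exact_mod_cast this
      linarith
    have h2 : (3 / 4 : ℝ) ≤ (1 - 1 / (4 * Δ : ℕ)) ^ Δ := by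
      have h3 : (1 / (4 * Δ : ℕ) : ℝ) ≤ 1 := by
        rw [div_le_one (by positivity)]
        push_cast
        linarith
      have h4 := one_add_mul_le_pow (a := (-(1 / (4 * Δ : ℕ)) : ℝ)) (by linarith) Δ
      have h5 : (1 : ℝ) + Δ * (-(1 / (4 * Δ : ℕ))) = 3 / 4 := by
        push_cast
        field_simp
        norm_num
      rw [h5, ← sub_eq_add_neg] at h4
      exact h4
    have h3 : (729 / 4096 : ℝ) ≤ (1 - 1 / (4 * Δ : ℕ)) ^ (6 * Δ) := by
      rw [mul_comm 6 Δ, pow_mul]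
      calc (729 / 4096 : ℝ) = (3 / 4) ^ 6 := by norm_num
        _ ≤ _ := pow_le_pow_left₀ (by norm_num) h2 6
    have h4 : (1 / (4 * Δ : ℕ) : ℝ) ^ 2 = 1 / (16 * Δ ^ 2) := by
      push_cast
      field_simp
      norm_num
    rw [h4]
    have h5 : 9 / 10 * (a * (Δ : ℝ) ^ 2) / 4 * (1 / (16 * Δ ^ 2) * (729 / 4096)) ≤
        #H / 4 * (1 / (16 * Δ ^ 2) * (1 - 1 / (4 * Δ : ℕ)) ^ (6 * Δ)) := by
      refine mul_le_mul (by linarith) ?_ (by positivity) (by positivity)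
      exact mul_le_mul_of_nonneg_left h3 (by positivity)
    have h6 : 9 / 10 * (a * (Δ : ℝ) ^ 2) / 4 * (1 / (16 * Δ ^ 2) * (729 / 4096)) =
        a * (9 * 729 / (640 * 4096)) := by
      field_simp
      ring
    rw [h6] at h5
    have h7 := mul_le_mul h1 h5 (by positivity) (by positivity)
    have h8 : 0 ≤ a * Δ := by positivity
    nlinarith

/-- The quantitative form of the colouring theorem, with the number of colours `q` and the target
`s` for the number of good colours at each vertex as parameters. -/
theorem exists_isDicolouring_of_sparse (D : Digraph V) (hD : D.IsLoopless) {q : ℕ} {a s : ℝ}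
    (hΔ : 20 ≤ D.maxDeg) (ha : 0 ≤ a) (hs : s ≤ a * D.maxDeg / 2500)
    (hq : (D.maxDeg : ℝ) + 1 - s ≤ q) (hCq : D.maxDeg / 2 ≤ q)
    (hm : ∀ v, ((min (D.mOut v) (D.mIn v) : ℕ) : ℝ) ≤
      (1 - a) * (D.maxDeg : ℝ) * ((D.maxDeg : ℝ) - 1))
    (hexp : 8 * (2 * (D.maxDeg : ℝ) + 1) ^ 4 ≤ Real.exp (a * D.maxDeg / 10000)) :
    ∃ α : V → Fin q, D.IsDicolouring α := by
  set Δ := D.maxDeg with hΔdef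
  have hΔ' : (20 : ℝ) ≤ Δ := by exact_mod_cast hΔ
  have : NeZero (4 * Δ) := ⟨by omega⟩
  let G : V → (V → Fin (Δ / 2) → Fin (4 * Δ)) → Finset (Fin (Δ / 2)) := fun v ω =>
    univ.filter fun c =>
      IsGood (D.missingPairs (D.sparseSide v)) (D.spoilers (D.sparseSide v)) ω c
  let A : V → Set (V → Fin (Δ / 2) → Fin (4 * Δ)) := fun v =>
    {ω | ¬ #(D.sparseSide v) < q + #(G v ω)}
  have hA : ∀ v, ∀ ω ω' : V → Fin (Δ / 2) → Fin (4 * Δ),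
      (∀ x ∈ D.ballTwo v, ω x = ω' x) → ω ∈ A v → ω' ∈ A v := by
    intro v ω ω' h hω
    have : G v ω = G v ω' := filter_congr fun c _ =>
      ⟨isGood_of_eqOn_ballTwo (D.sparseSide_subset v) h,
        isGood_of_eqOn_ballTwo (D.sparseSide_subset v) fun x hx => (h x hx).symm⟩
    have h1 : ¬ #(D.sparseSide v) < q + #(G v ω) := hω
    rw [this] at h1
    exact h1
  have hp : ∀ v, prob (A v) ≤ 2 * Real.exp (-(a * Δ / 10000)) := by
    intro v
    by_cases hlt : #(D.sparseSide v) < q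
    · have : A v = ∅ := Set.eq_empty_of_forall_notMem fun ω hω => hω (by omega)
      rw [this]
      simp only [prob, Set.indicator_empty, expect_const_zero]
      positivity
    have hnq : (q : ℝ) ≤ #(D.sparseSide v) := by exact_mod_cast not_lt.1 hlt
    have hnΔ : (#(D.sparseSide v) : ℝ) ≤ Δ := by exact_mod_cast D.card_sparseSide_le v
    have hcard := D.card_missingPairs hD (D.sparseSide v)
    rw [arcCount_induce_sparseSide] at hcard
    have h0 : 0 ≤ a * Δ := by positivity
    have hH := le_card_missing (s := s) hΔ' ha (Nat.cast_nonneg _) hnΔ (by linarith)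
      (by linarith) (hm v) (h := #(D.missingPairs (D.sparseSide v))) (by exact_mod_cast hcard)
    refine (prob_mono fun ω hω => ?_).trans (prob_few_good_le_exp
      (H := D.missingPairs (D.sparseSide v)) ?_ (D.spoilers (D.sparseSide v)) ?_ ?_ hΔ
      (D.card_sparseSide_le v) ha hH hs)
    · have h1 : ((q + #(G v ω) : ℕ) : ℝ) ≤ #(D.sparseSide v) := by exact_mod_cast not_lt.1 hω
      push_cast at h1
      show (#(G v ω) : ℝ) < s
      linarith
    · intro p hp
      exact mem_offDiag.1 (mem_filter.1 hp).1
    · exact fun p _ => subset_union_left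
    · intro p _
      have h1 := card_union_le (D.sparseSide v) (D.closedNbhd p.1 ∪ D.closedNbhd p.2)
      have h2 := card_union_le (D.closedNbhd p.1) (D.closedNbhd p.2)
      have h3 := D.card_closedNbhd_le p.1
      have h4 := D.card_closedNbhd_le p.2
      have h5 := D.card_sparseSide_le v
      unfold spoilers
      omega
  obtain ⟨ω, hω⟩ := exists_forall_notMem_of_local D.ballTwo A hA hp D.card_ballTwo_meeting_le
    (Nat.one_le_pow _ _ (by omega)) (by
      rw [Real.exp_neg]
      push_cast
      rw [← hΔdef]
      have := Real.exp_pos (a * Δ / 10000)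
      field_simp
      linarith)
  exact D.exists_isDicolouring_of_good hD hCq D.sparseSide D.coversSide_sparseSide ω
    fun v => not_not.1 (hω v)

end

end Digraph

theorem corollary3p1 :
    ∃ Δ₁ : ℕ, 2 ≤ Δ₁ ∧
      ∀ (V : Type*) [Fintype V] (D : Digraph V), D.IsLoopless →
        ∀ Δ : ℕ, D.maxDeg = Δ → Δ₁ ≤ Δ →
          ∀ a : ℝ, Real.log (Δ : ℝ) ^ 3 / ((Δ : ℝ) - 1) < a →
            (∀ v : V, ((min (D.mOut v) (D.mIn v) : ℕ) : ℝ) ≤ (1 - a) * (Δ : ℝ) * ((Δ : ℝ) - 1)) →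
              (D.dichromaticNumber : ℝ) ≤ (1 - a / (5 * Real.exp 7)) * ((Δ : ℝ) + 1) := by
  have hexp300 : (301 : ℝ) ≤ Real.exp 300 := by linarith [Real.add_one_le_exp (300 : ℝ)]
  refine ⟨⌈Real.exp 300⌉₊, ?_, ?_⟩
  · exact_mod_cast (show (2 : ℝ) ≤ 301 by norm_num).trans (hexp300.trans (Nat.le_ceil _))
  intro V _ D hD Δ hΔD hΔ a ha hm
  subst hΔD
  have hΔe : Real.exp 300 ≤ D.maxDeg := Nat.ceil_le.1 hΔ
  set Δ := D.maxDeg with hΔdef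
  have hΔ301 : (301 : ℝ) ≤ Δ := hexp300.trans hΔe
  have hΔ20 : 20 ≤ Δ := by
    have : ((20 : ℕ) : ℝ) ≤ Δ := by push_cast; linarith
    exact_mod_cast this
  have hlog : 300 ≤ Real.log Δ := (Real.le_log_iff_exp_le (by linarith)).2 hΔe
  have hlog3 : (300 : ℝ) ^ 3 ≤ Real.log Δ ^ 3 := pow_le_pow_left₀ (by norm_num) hlog 3
  rw [div_lt_iff₀ (by linarith)] at ha
  have ha0 : 0 < a := by
    by_contra! h
    nlinarith
  have ha1 : a ≤ 1 := by
    -- A digraph of positive maximum degree has a vertex.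
    obtain ⟨v⟩ : Nonempty V := by
      by_contra hV
      rw [not_nonempty_iff] at hV
      have : Δ = 0 := by rw [hΔdef, Digraph.maxDeg, Finset.univ_eq_empty, Finset.sup_empty]; rfl
      omega
    have h1 : 0 ≤ (1 - a) * (Δ : ℝ) * ((Δ : ℝ) - 1) := (Nat.cast_nonneg _).trans (hm v)
    have h2 : (0 : ℝ) < Δ * ((Δ : ℝ) - 1) := mul_pos (by linarith) (by linarith)
    by_contra! h
    nlinarith
  have he7 : Real.exp 7 = Real.exp 1 ^ 7 := by
    rw [← Real.exp_nat_mul]; norm_num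
  have he7l : (1000 : ℝ) ≤ Real.exp 7 := by
    rw [he7]
    calc (1000 : ℝ) ≤ 2.7182818283 ^ 7 := by norm_num
      _ ≤ _ := pow_le_pow_left₀ (by norm_num) Real.exp_one_gt_d9.le 7
  have he7u : Real.exp 7 ≤ 2000 := by
    rw [he7]
    calc Real.exp 1 ^ 7 ≤ 2.7182818286 ^ 7 :=
          pow_le_pow_left₀ (Real.exp_nonneg _) Real.exp_one_lt_d9.le 7
      _ ≤ _ := by norm_num
  set δ := a / (5 * Real.exp 7) with hδ
  have hδa : δ * (5 * Real.exp 7) = a := by rw [hδ]; field_simp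
  have hδ0 : 0 < δ := by positivity
  have hδu : δ ≤ a / 5000 := by nlinarith
  have hδl : 1 ≤ δ * ((Δ : ℝ) - 1) := by
    have h1 : a / 10000 ≤ δ := by nlinarith
    nlinarith
  set q := ⌊(1 - δ) * ((Δ : ℝ) + 1)⌋₊ with hq
  have hqu : (q : ℝ) ≤ (1 - δ) * ((Δ : ℝ) + 1) :=
    Nat.floor_le (mul_nonneg (by linarith) (by linarith))
  -- The floor costs one colour; `s = 2 δ Δ` good colours make up for it, because
  -- `δ (Δ + 1) + 1 ≤ 2 δ Δ`.
  have hql : (1 - δ) * ((Δ : ℝ) + 1) < q + 1 := Nat.lt_floor_add_one _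
  have hsu : 2 * δ * Δ ≤ a * Δ / 2500 := by nlinarith
  have hqs : (Δ : ℝ) + 1 - 2 * δ * Δ ≤ q := by linarith
  refine le_trans ?_ hqu
  have hdic := D.exists_isDicolouring_of_sparse hD (q := q) (s := 2 * δ * Δ) hΔ20 ha0.le hsu hqs
    (by
      have h1 : ((Δ / 2 : ℕ) : ℝ) ≤ Δ / 2 := Nat.cast_div_le
      have h2 : ((Δ / 2 : ℕ) : ℝ) ≤ q := by nlinarith
      exact_mod_cast h2) hm (by
      have h1 : (2 * (Δ : ℝ) + 1) ^ 4 ≤ (3 * Δ) ^ 4 :=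
        pow_le_pow_left₀ (by linarith) (by linarith) 4
      have h2 : (301 : ℝ) ^ 4 ≤ (Δ : ℝ) ^ 4 := pow_le_pow_left₀ (by norm_num) hΔ301 4
      have h3 : (Δ : ℝ) ^ 8 ≤ Real.exp (a * Δ / 10000) := by
        have h4 : (Δ : ℝ) ^ 8 = Real.exp (8 * Real.log Δ) := by
          rw [mul_comm, Real.exp_mul, Real.exp_log (by linarith)]
          exact_mod_cast rfl
        rw [h4]
        refine Real.exp_le_exp.2 ?_
        -- As `log Δ ≥ 300`, the bound `a Δ > log³ Δ` gives `a Δ / 10000 > 8 log Δ`.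
        have h5 : (300 : ℝ) ^ 2 * Real.log Δ ≤ Real.log Δ ^ 3 := by
          have := mul_le_mul_of_nonneg_right (pow_le_pow_left₀ (by norm_num) hlog 2)
            (by linarith : (0 : ℝ) ≤ Real.log Δ)
          linarith [pow_succ (Real.log (Δ : ℝ)) 2]
        linarith
      nlinarith)
  exact_mod_cast Nat.sInf_le hdic
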